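/- All graphs are finite, simple and undirected. A set $F$ of vertices of a graph $G$ is a *dissociation set* if the induced subgraph $G[F]$ has maximum degree at most $1$; a *maximum dissociation set* of $G$ is a dissociation set of the largest cardinality among all dissociation sets of $G$. Let $\phi'(G)$ denote the number of maximum dissociation sets of $G$. **Theorem.** Let $G$ be a triangle-free graph of order $n$ (that is, with $n$ vertices). Then $$\phi'(G)\le 6^{n/4}.$$ Furthermore, $\phi'(G)=6^{n/4}$ if and only if $n\equiv 0\pmod 4$ and $G$ is isomorphic to $\frac n4 C_4$, the disjoint union of $n/4$ copies of the cycle $C_4$ on four vertices (the graph without vertices if $n=0$). -/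

import Mathlib

namespace SimpleGraph

open Classical in
/-- A set `F` of vertices of `G` is a *dissociation set* if the induced subgraph `G[F]` has
maximum degree at most `1`. -/
def IsDissociationSet {V : Type*} (G : SimpleGraph V) (F : Finset V) : Prop :=
  (G.induce (F : Set V)).maxDegree ≤ 1

/-- A *maximum dissociation set* is a dissociation set of maximum size. -/
def IsMaximumDissociationSet {V : Type*} (G : SimpleGraph V) (F : Finset V) : Prop :=
  G.IsDissociationSet F ∧ ∀ F' : Finset V, G.IsDissociationSet F' → F'.card ≤ F.card

/-- `φ'(G)`: the number of maximum dissociation sets of the finite graph `G`. -/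
noncomputable def numMaximumDissociationSets {V : Type*} [Fintype V] (G : SimpleGraph V) : ℕ :=
  {F : Finset V | G.IsMaximumDissociationSet F}.ncard

/-- `ℓH`: the disjoint union of `ℓ` copies of `H` (the graph without vertices when `ℓ = 0`). -/
def disjointCopies {W : Type*} (l : ℕ) (H : SimpleGraph W) : SimpleGraph (Fin l × W) where
  Adj x y := x.1 = y.1 ∧ H.Adj x.2 y.2
  symm := ⟨fun _ _ h => ⟨h.1.symm, h.2.symm⟩⟩
  loopless := ⟨fun x h => H.loopless.irrefl x.2 h.2⟩

end SimpleGraph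

namespace SimpleGraph

open Finset

/-! ### Normalised counts and the deletion inequality -/

section Weights

open scoped Classical

variable {V : Type*} {G : SimpleGraph V}

/-! Normalise the count for `G[S]` by `rho ^ #S`, where `rho ^ 4 = 1/6`; the claim becomes `weight G
S ≤ 1`, proved by strong induction on `S`. If a family of maximum dissociation sets has one fixed
trace `P` on `D`, and all neighbours of `P` lie in `D`, then removing `D` injects the family into
the maximum dissociation sets of `G[S \ D]`. By induction it contributes at most `rho ^ #D`
(`mass_le_of_inter_eq`). Maximality provides short lists of such families covering everything: a
vertex is omitted, is isolated in `F`, or lies on an edge of `F`. Triangle-freeness makes the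
neighbourhoods of adjacent vertices disjoint, so prescribing an edge deletes as many vertices as the
two degrees together.

These branchings give weight below 1 when some degree is at most 1 or at least 4, when degrees 2 and
3 are adjacent, when a component is cubic, or when a 2-regular graph has a cycle longer than 4. What
remains is empty or has a `C_4` component. Such a component meets every maximum dissociation set in
exactly two vertices, and `6 * rho ^ 4 = 1`, so deleting it does not lower the weight; equality
therefore passes to the rest and forces a union of four-cycles (`weight_le_one_and`). Conversely,
choosing two vertices freely in each of `l` four-cycles gives `6 ^ l` maximum sets. -/

/-- Elementwise form of dissociation: no vertex of `F` has two neighbours in `F`. -/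
def IsDissoc (G : SimpleGraph V) (F : Finset V) : Prop :=
  ∀ v ∈ F, ∀ a ∈ F, ∀ b ∈ F, G.Adj v a → G.Adj v b → a = b

/-- The neighbours of `v` inside `S`. -/
noncomputable def nbrs (G : SimpleGraph V) (S : Finset V) (v : V) : Finset V :=
  S.filter (G.Adj v)

/-- The dissociation sets contained in `S` of maximum size. -/
noncomputable def maxDissoc (G : SimpleGraph V) (S : Finset V) : Finset (Finset V) :=
  S.powerset.filter fun F => IsDissoc G F ∧ ∀ F' ⊆ S, IsDissoc G F' → #F' ≤ #F

/-- The number `6 ^ (-1/4)`. -/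
noncomputable def rho : ℝ := (6 : ℝ) ^ (-(1 / 4) : ℝ)

/-- The number of maximum dissociation sets of `G[S]` satisfying `p`, relative to `6 ^ (|S|/4)`. -/
noncomputable def mass (G : SimpleGraph V) (S : Finset V) (p : Finset V → Prop) : ℝ :=
  #((maxDissoc G S).filter p) * rho ^ #S

/-- The number of maximum dissociation sets of `G[S]`, relative to `6 ^ (|S|/4)`. -/
noncomputable def weight (G : SimpleGraph V) (S : Finset V) : ℝ :=
  #(maxDissoc G S) * rho ^ #S

/-! ### Numerical estimates for powers of `rho` -/

lemma rho_pos : 0 < rho := by unfold rho; positivity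

lemma rho_pow_four : rho ^ 4 = 1 / 6 := by
  unfold rho
  rw [← Real.rpow_natCast, ← Real.rpow_mul (by norm_num)]
  norm_num

lemma rho_lt : rho < 0.639 := by
  refine lt_of_pow_lt_pow_left₀ 4 (by norm_num) ?_
  rw [rho_pow_four]; norm_num

lemma rho_le_one : rho ≤ 1 := by linarith [rho_lt]

lemma rho_sq_lt : rho ^ 2 < 0.40825 := by
  refine lt_of_pow_lt_pow_left₀ 2 (by norm_num) ?_
  rw [← pow_mul, rho_pow_four]; norm_num

lemma rho_cube_lt : rho ^ 3 < 0.2609 := by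
  have h : rho ^ 3 = rho * rho ^ 2 := by ring
  rw [h]
  nlinarith [rho_pos, rho_lt, rho_sq_lt]

lemma rho_pow_five : rho ^ 5 = rho / 6 := by
  have h : rho ^ 5 = rho * rho ^ 4 := by ring
  rw [h, rho_pow_four]; ring

lemma rho_pow_six : rho ^ 6 = rho ^ 2 / 6 := by
  have h : rho ^ 6 = rho ^ 2 * rho ^ 4 := by ring
  rw [h, rho_pow_four]; ring

lemma rho_pow_seven : rho ^ 7 = rho ^ 3 / 6 := by
  have h : rho ^ 7 = rho ^ 3 * rho ^ 4 := by ring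
  rw [h, rho_pow_four]; ring

lemma rho_pow_le {m k : ℕ} (h : k ≤ m) : rho ^ m ≤ rho ^ k :=
  pow_le_pow_of_le_one rho_pos.le rho_le_one h

/-- The sequence `d * rho ^ (d + k)` is decreasing from `d = 2` on. -/
lemma mul_rho_pow_le {m d : ℕ} (k : ℕ) (hm : 2 ≤ m) (h : m ≤ d) :
    d * rho ^ (d + k) ≤ m * rho ^ (m + k) := by
  induction d, h using Nat.le_induction with
  | base => exact le_rfl
  | succ d hd ih =>
    refine le_trans ?_ ih
    have e : rho ^ (d + 1 + k) = rho ^ (d + k) * rho := by ring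
    rw [e]
    have h2 : (2 : ℝ) ≤ d := by exact_mod_cast hm.trans hd
    have hp : 0 < rho ^ (d + k) := pow_pos rho_pos _
    -- Consecutive terms have ratio `(d + 1) * rho / d`, at most `3 * rho / 2 < 1` once `d ≥ 2`.
    have : ((d : ℝ) + 1) * rho ≤ d := by nlinarith [rho_lt]
    push_cast
    nlinarith

lemma mem_nbrs {S : Finset V} {v w : V} : w ∈ nbrs G S v ↔ w ∈ S ∧ G.Adj v w := by
  simp [nbrs]

lemma nbrs_subset (S : Finset V) (v : V) : nbrs G S v ⊆ S := filter_subset _ _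

lemma mem_maxDissoc {S F : Finset V} : F ∈ maxDissoc G S ↔
    F ⊆ S ∧ IsDissoc G F ∧ ∀ F' ⊆ S, IsDissoc G F' → #F' ≤ #F := by
  simp [maxDissoc]

lemma IsDissoc.mono {A B : Finset V} (h : IsDissoc G B) (hAB : A ⊆ B) : IsDissoc G A :=
  fun v hv a ha b hb => h v (hAB hv) a (hAB ha) b (hAB hb)

lemma IsDissoc.union {A B : Finset V} (hA : IsDissoc G A) (hB : IsDissoc G B)
    (h : ∀ a ∈ A, ∀ b ∈ B, ¬ G.Adj a b) : IsDissoc G (A ∪ B) := by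
  intro v hv a ha b hb h1 h2
  rw [mem_union] at hv ha hb
  rcases hv with hv | hv
  · have ha' : a ∈ A := ha.resolve_right fun h' => h v hv a h' h1
    have hb' : b ∈ A := hb.resolve_right fun h' => h v hv b h' h2
    exact hA v hv a ha' b hb' h1 h2
  · have ha' : a ∈ B := ha.resolve_left fun h' => h a h' v hv h1.symm
    have hb' : b ∈ B := hb.resolve_left fun h' => h b h' v hv h2.symm
    exact hB v hv a ha' b hb' h1 h2

/-- A maximum dissociation set cannot be enlarged. -/
lemma not_isDissoc_insert {S F : Finset V} (hF : F ∈ maxDissoc G S) {z : V} (hz : z ∈ S)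
    (hzF : z ∉ F) : ¬ IsDissoc G (insert z F) := by
  intro h
  rw [mem_maxDissoc] at hF
  have := hF.2.2 _ (insert_subset hz hF.1) h
  rw [card_insert_of_notMem hzF] at this
  omega

lemma isDissoc_singleton (v : V) : IsDissoc G {v} := by
  intro a _ b hb c hc _ _
  rw [mem_singleton] at hb hc
  rw [hb, hc]

lemma isDissoc_pair (u v : V) : IsDissoc G {u, v} := by
  intro a ha b hb c hc h1 h2
  simp only [mem_insert, mem_singleton] at ha hb hc
  rcases ha with rfl | rfl <;> rcases hb with rfl | rfl <;> rcases hc with rfl | rfl <;>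
    first
    | rfl
    | exact absurd h1 (G.loopless.irrefl _)
    | exact absurd h2 (G.loopless.irrefl _)

lemma isDissoc_insert_of_forall_not_adj {F : Finset V} (hF : IsDissoc G F) {z : V}
    (h : ∀ w ∈ F, ¬ G.Adj z w) : IsDissoc G (insert z F) := by
  rw [insert_eq]
  refine (isDissoc_singleton z).union hF ?_
  intro a ha
  rw [mem_singleton] at ha
  exact ha ▸ h

/-- A vertex whose only neighbour in `F` is isolated in `F` can be added to `F`. -/
lemma isDissoc_insert_of_isolated {F : Finset V} (hF : IsDissoc G F) {z a : V} (ha : a ∈ F)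
    (haF : ∀ w ∈ F, ¬ G.Adj a w) (h : ∀ w ∈ F, G.Adj z w → w = a) :
    IsDissoc G (insert z F) := by
  have e : insert z F = {z, a} ∪ F.erase a := by
    ext w; simp only [mem_insert, mem_union, mem_singleton, mem_erase]
    by_cases hw : w = a
    · subst hw; simp [ha]
    · simp [hw]
  rw [e]
  refine (isDissoc_pair z a).union (hF.mono (erase_subset _ _)) ?_
  intro c hc w hw hcw
  simp only [mem_insert, mem_singleton] at hc
  rw [mem_erase] at hw
  rcases hc with rfl | rfl
  · exact hw.1 (h w hw.2 hcw)
  · exact haF w hw.2 hcw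

/-- An exchange: no edge joins `F ∩ D` to `S \ D`, so a larger dissociation set outside `D` could
replace `F \ D` and enlarge `F`. -/
lemma maxDissoc_sdiff {S D F : Finset V} (hF : F ∈ maxDissoc G S)
    (hP : ∀ v ∈ F ∩ D, nbrs G S v ⊆ D) : F \ D ∈ maxDissoc G (S \ D) := by
  rw [mem_maxDissoc] at hF ⊢
  refine ⟨sdiff_subset_sdiff hF.1 le_rfl, hF.2.1.mono sdiff_subset, fun F' hF' hd => ?_⟩
  have hdis : Disjoint (F ∩ D) F' := by
    rw [Finset.disjoint_left]
    intro a ha ha'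
    exact (mem_sdiff.1 (hF' ha')).2 (mem_inter.1 ha).2
  have h1 : IsDissoc G (F ∩ D ∪ F') := by
    refine (hF.2.1.mono inter_subset_left).union hd ?_
    intro a ha b hb hab
    have hb' := mem_sdiff.1 (hF' hb)
    exact hb'.2 (hP a ha (mem_nbrs.2 ⟨hb'.1, hab⟩))
  have h2 := hF.2.2 _ (union_subset (inter_subset_left.trans hF.1)
    (hF'.trans sdiff_subset)) h1
  rw [card_union_of_disjoint hdis] at h2
  have h3 := card_sdiff_add_card_inter F D
  omega

lemma card_filter_le_of_inter_eq {S D P : Finset V} {p : Finset V → Prop}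
    (hp : ∀ F ∈ maxDissoc G S, p F → F ∩ D = P) (hP : ∀ v ∈ P, nbrs G S v ⊆ D) :
    #((maxDissoc G S).filter p) ≤ #(maxDissoc G (S \ D)) := by
  refine card_le_card_of_injOn (fun F => F \ D) ?_ ?_
  · intro F hF
    rw [mem_coe, mem_filter] at hF
    exact maxDissoc_sdiff hF.1 (by rw [hp F hF.1 hF.2]; exact hP)
  · intro F hF F' hF' h
    rw [mem_coe, mem_filter] at hF hF'
    have h1 := hp F hF.1 hF.2
    have h2 := hp F' hF'.1 hF'.2
    rw [← sdiff_union_inter F D, ← sdiff_union_inter F' D, h1, h2]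
    exact congrArg (· ∪ P) h

/-- Deleting a set `D` on which the trace `P` of the dissociation sets is prescribed, where all
neighbours of `P` lie in `D`. -/
lemma mass_le_of_inter_eq {S D P : Finset V} (hD : D ⊆ S) {p : Finset V → Prop}
    (hp : ∀ F ∈ maxDissoc G S, p F → F ∩ D = P) (hP : ∀ v ∈ P, nbrs G S v ⊆ D) :
    mass G S p ≤ rho ^ #D * weight G (S \ D) := by
  have h := card_filter_le_of_inter_eq hp hP
  have e : rho ^ #S = rho ^ #D * rho ^ #(S \ D) := by
    rw [← pow_add, add_comm, card_sdiff_add_card_eq_card hD]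
  have h' : (#((maxDissoc G S).filter p) : ℝ) ≤ #(maxDissoc G (S \ D)) := by exact_mod_cast h
  unfold mass weight
  calc _ ≤ (#(maxDissoc G (S \ D)) : ℝ) * rho ^ #S :=
        mul_le_mul_of_nonneg_right h' (pow_pos rho_pos _).le
    _ = _ := by rw [e]; ring

lemma weight_eq_mass (S : Finset V) : weight G S = mass G S fun _ => True := by
  simp [weight, mass]

lemma mass_le_add {S : Finset V} {p q r : Finset V → Prop}
    (h : ∀ F ∈ maxDissoc G S, r F → p F ∨ q F) : mass G S r ≤ mass G S p + mass G S q := by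
  unfold mass
  rw [← add_mul]
  refine mul_le_mul_of_nonneg_right ?_ (pow_pos rho_pos _).le
  have hc := card_union_le ((maxDissoc G S).filter p) ((maxDissoc G S).filter q)
  refine le_trans (Nat.cast_le.2 (card_le_card
    (t := (maxDissoc G S).filter p ∪ (maxDissoc G S).filter q) fun F hF => ?_)) (mod_cast hc)
  rw [mem_filter] at hF
  rw [mem_union, mem_filter, mem_filter]
  exact (h F hF.1 hF.2).imp (fun h => ⟨hF.1, h⟩) fun h => ⟨hF.1, h⟩

lemma mass_or_le (S : Finset V) (p q : Finset V → Prop) :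
    mass G S (fun F => p F ∨ q F) ≤ mass G S p + mass G S q :=
  mass_le_add fun _ _ h => h

lemma mass_mono {S : Finset V} {p q : Finset V → Prop}
    (h : ∀ F ∈ maxDissoc G S, p F → q F) : mass G S p ≤ mass G S q := by
  unfold mass
  refine mul_le_mul_of_nonneg_right ?_ (pow_pos rho_pos _).le
  have : #((maxDissoc G S).filter p) ≤ #((maxDissoc G S).filter q) := by
    refine card_le_card fun F hF => ?_
    rw [mem_filter] at hF ⊢
    exact ⟨hF.1, h F hF.1 hF.2⟩
  exact_mod_cast this

lemma weight_le_mass {S : Finset V} {p : Finset V → Prop}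
    (h : ∀ F ∈ maxDissoc G S, p F) : weight G S ≤ mass G S p := by
  rw [weight_eq_mass]
  exact mass_mono fun F hF _ => h F hF

lemma mass_exists_le {ι : Type*} (S : Finset V) (C : Finset ι) (p : ι → Finset V → Prop) :
    mass G S (fun F => ∃ c ∈ C, p c F) ≤ ∑ c ∈ C, mass G S (p c) := by
  induction C using Finset.induction_on with
  | empty => simp [mass]
  | insert c C hc ih =>
    rw [sum_insert hc]
    refine le_trans ?_ (add_le_add_right ih _)
    refine le_trans (mass_mono ?_) (mass_or_le _ _ _)
    intro F _ h
    simpa using h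

lemma mass_exists_le_card_mul {ι : Type*} (S : Finset V) (C : Finset ι)
    (p : ι → Finset V → Prop) {t : ℝ} (h : ∀ c ∈ C, mass G S (p c) ≤ t) :
    mass G S (fun F => ∃ c ∈ C, p c F) ≤ #C * t := by
  refine (mass_exists_le S C p).trans ?_
  rw [← nsmul_eq_mul]
  exact sum_le_card_nsmul _ _ _ h

/-- The event that `v` is an isolated vertex of `G[F]`. -/
def IsolatedIn (G : SimpleGraph V) (v : V) (F : Finset V) : Prop :=
  v ∈ F ∧ ∀ w ∈ F, ¬ G.Adj v w

/-- The deleted set is the closed neighbourhood of `v`, on which the trace is `{v}`. -/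
lemma mass_isolatedIn_le {S : Finset V} {v : V} (hv : v ∈ S) :
    mass G S (IsolatedIn G v) ≤
      rho ^ (#(nbrs G S v) + 1) * weight G (S \ insert v (nbrs G S v)) := by
  have hn : v ∉ nbrs G S v := by simp [mem_nbrs]
  have h := mass_le_of_inter_eq (G := G) (S := S) (D := insert v (nbrs G S v)) (P := {v})
    (p := IsolatedIn G v) (insert_subset hv (nbrs_subset _ _)) ?_ ?_
  · rwa [card_insert_of_notMem hn] at h
  · rintro F - ⟨h1, h2⟩
    ext w
    simp only [mem_inter, mem_insert, mem_nbrs, mem_singleton]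
    constructor
    · rintro ⟨hw, rfl | ⟨-, h3⟩⟩
      · rfl
      · exact absurd h3 (h2 w hw)
    · rintro rfl
      exact ⟨h1, Or.inl rfl⟩
  · intro w hw
    rw [mem_singleton] at hw
    subst hw
    exact subset_insert _ _

lemma disjoint_nbrs (ht : ∀ a b c, G.Adj a b → G.Adj a c → ¬ G.Adj b c) {S : Finset V} {u v : V}
    (huv : G.Adj u v) : Disjoint (nbrs G S u) (nbrs G S v) := by
  rw [Finset.disjoint_left]
  intro w h1 h2
  rw [mem_nbrs] at h1 h2
  exact ht u v w huv h1.2 h2.2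

/-- An edge `uv` inside `F` excludes all other neighbours of its ends. The set `N(u) ∪ N(v)` already
contains `u` and `v`, and it is a disjoint union because there are no triangles; hence the exponent
is the sum of the degrees. -/
lemma mass_pair_le (ht : ∀ a b c, G.Adj a b → G.Adj a c → ¬ G.Adj b c) {S : Finset V} {u v : V}
    (hu : u ∈ S) (hv : v ∈ S) (huv : G.Adj u v) :
    mass G S (fun F => u ∈ F ∧ v ∈ F) ≤
      rho ^ (#(nbrs G S u) + #(nbrs G S v)) * weight G (S \ (nbrs G S u ∪ nbrs G S v)) := by
  have h := mass_le_of_inter_eq (G := G) (S := S) (D := nbrs G S u ∪ nbrs G S v) (P := {u, v})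
    (p := fun F => u ∈ F ∧ v ∈ F) (union_subset (nbrs_subset _ _) (nbrs_subset _ _)) ?_ ?_
  · rwa [card_union_of_disjoint (disjoint_nbrs ht huv)] at h
  · rintro F hF ⟨h1, h2⟩
    rw [mem_maxDissoc] at hF
    ext w
    simp only [mem_inter, mem_insert, mem_nbrs, mem_singleton, mem_union]
    constructor
    · rintro ⟨hw, ⟨-, h3⟩ | ⟨-, h3⟩⟩
      · exact Or.inr (hF.2.1 u h1 w hw v h2 h3 huv)
      · exact Or.inl (hF.2.1 v h2 w hw u h1 h3 huv.symm)
    · rintro (rfl | rfl)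
      · exact ⟨h1, Or.inr ⟨hu, huv.symm⟩⟩
      · exact ⟨h2, Or.inl ⟨hv, huv⟩⟩
  · intro w hw
    rw [mem_insert, mem_singleton] at hw
    rcases hw with rfl | rfl
    · exact subset_union_left
    · exact subset_union_right

lemma mass_notMem_le {S : Finset V} {v : V} (hv : v ∈ S) :
    mass G S (fun F => v ∉ F) ≤ rho * weight G (S.erase v) := by
  have h := mass_le_of_inter_eq (G := G) (S := S) (D := {v}) (P := ∅)
    (p := fun F => v ∉ F) (by simpa using hv) (fun F _ h => inter_singleton_of_notMem h) (by simp)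
  rwa [card_singleton, pow_one, sdiff_singleton_eq_erase] at h

lemma mass_isolatedIn_pair_le {S : Finset V} {a b : V} (ha : a ∈ S) (hb : b ∈ S) (hne : a ≠ b)
    (hab : ¬ G.Adj a b) :
    mass G S (fun F => IsolatedIn G a F ∧ IsolatedIn G b F) ≤
      rho ^ (#(nbrs G S a ∪ nbrs G S b) + 2) *
        weight G (S \ ({a, b} ∪ (nbrs G S a ∪ nbrs G S b))) := by
  have hdis : Disjoint {a, b} (nbrs G S a ∪ nbrs G S b) := by
    have hba : ¬ G.Adj b a := fun h => hab h.symm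
    simp [mem_nbrs, hab, hba]
  have h := mass_le_of_inter_eq (G := G) (S := S) (D := {a, b} ∪ (nbrs G S a ∪ nbrs G S b))
    (P := {a, b}) (p := fun F => IsolatedIn G a F ∧ IsolatedIn G b F) ?_ ?_ ?_
  · rwa [card_union_of_disjoint hdis, card_pair hne, add_comm 2] at h
  · refine union_subset ?_ (union_subset (nbrs_subset _ _) (nbrs_subset _ _))
    simp [insert_subset_iff, ha, hb]
  · rintro F - ⟨h1, h2⟩
    ext w
    simp only [mem_inter, mem_insert, mem_nbrs, mem_singleton, mem_union]
    constructor
    · rintro ⟨hw, h3 | ⟨-, h3⟩ | ⟨-, h3⟩⟩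
      · exact h3
      · exact absurd h3 (h1.2 w hw)
      · exact absurd h3 (h2.2 w hw)
    · rintro (rfl | rfl)
      · exact ⟨h1.1, Or.inl (Or.inl rfl)⟩
      · exact ⟨h2.1, Or.inl (Or.inr rfl)⟩
  · intro w hw
    rw [mem_insert, mem_singleton] at hw
    rcases hw with rfl | rfl
    · exact subset_union_left.trans subset_union_right
    · exact subset_union_right.trans subset_union_right

end Weights

end SimpleGraph

namespace SimpleGraph

open Finset

section Branching

open scoped Classical

variable {V : Type*} {G : SimpleGraph V}

/-! ### Branching on vertices of small or large degree -/

lemma weight_sdiff_le_one {S D : Finset V} (hI : ∀ T ⊂ S, weight G T ≤ 1) {v : V} (hv : v ∈ S)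
    (hD : v ∈ D) : weight G (S \ D) ≤ 1 := by
  refine hI _ ((ssubset_iff_of_subset sdiff_subset).2 ⟨v, hv, ?_⟩)
  simp [hD]

lemma mass_isolatedIn_le_pow {S : Finset V} (hI : ∀ T ⊂ S, weight G T ≤ 1) {v : V} (hv : v ∈ S)
    {k : ℕ} (hk : k ≤ #(nbrs G S v) + 1) : mass G S (IsolatedIn G v) ≤ rho ^ k := by
  refine (mass_isolatedIn_le hv).trans ?_
  calc _ ≤ rho ^ (#(nbrs G S v) + 1) * 1 := mul_le_mul_of_nonneg_left
        (weight_sdiff_le_one hI hv (mem_insert_self _ _)) (pow_pos rho_pos _).le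
    _ ≤ rho ^ k := by rw [mul_one]; exact rho_pow_le hk

lemma mass_pair_le_pow (ht : ∀ a b c, G.Adj a b → G.Adj a c → ¬ G.Adj b c) {S : Finset V}
    (hI : ∀ T ⊂ S, weight G T ≤ 1) {u v : V} (hu : u ∈ S) (hv : v ∈ S) (huv : G.Adj u v)
    {k : ℕ} (hk : k ≤ #(nbrs G S u) + #(nbrs G S v)) :
    mass G S (fun F => u ∈ F ∧ v ∈ F) ≤ rho ^ k := by
  refine (mass_pair_le ht hu hv huv).trans ?_
  calc _ ≤ rho ^ (#(nbrs G S u) + #(nbrs G S v)) * 1 := mul_le_mul_of_nonneg_left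
        (weight_sdiff_le_one hI hv (mem_union_left _ (mem_nbrs.2 ⟨hv, huv⟩)))
        (pow_pos rho_pos _).le
    _ ≤ rho ^ k := by rw [mul_one]; exact rho_pow_le hk

lemma mass_isolatedIn_pair_le_pow {S : Finset V} (hI : ∀ T ⊂ S, weight G T ≤ 1) {a b : V}
    (ha : a ∈ S) (hb : b ∈ S) (hne : a ≠ b) (hab : ¬ G.Adj a b)
    {k : ℕ} (hk : k ≤ #(nbrs G S a ∪ nbrs G S b) + 2) :
    mass G S (fun F => IsolatedIn G a F ∧ IsolatedIn G b F) ≤ rho ^ k := by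
  refine (mass_isolatedIn_pair_le ha hb hne hab).trans ?_
  calc _ ≤ rho ^ (#(nbrs G S a ∪ nbrs G S b) + 2) * 1 := mul_le_mul_of_nonneg_left
        (weight_sdiff_le_one hI ha (by simp)) (pow_pos rho_pos _).le
    _ ≤ rho ^ k := by rw [mul_one]; exact rho_pow_le hk

lemma card_nbrs_pos {S : Finset V} {u v : V} (hu : u ∈ S) (h : G.Adj v u) :
    1 ≤ #(nbrs G S v) := card_pos.2 ⟨u, mem_nbrs.2 ⟨hu, h⟩⟩

lemma weight_le_of_nbrs_eq_empty {S : Finset V} (hI : ∀ T ⊂ S, weight G T ≤ 1) {v : V}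
    (hv : v ∈ S) (h : nbrs G S v = ∅) : weight G S ≤ rho := by
  rw [← pow_one rho]
  refine (weight_le_mass fun F hF => ?_).trans
    (mass_isolatedIn_le_pow hI hv (k := 1) (by omega))
  have hF' := mem_maxDissoc.1 hF
  have h0 : ∀ w ∈ F, ¬ G.Adj v w := fun w hw hvw => by
    have : w ∈ nbrs G S v := mem_nbrs.2 ⟨hF'.1 hw, hvw⟩
    simp [h] at this
  refine ⟨?_, h0⟩
  by_contra hvF
  exact not_isDissoc_insert hF hv hvF (isDissoc_insert_of_forall_not_adj hF'.2.1 h0)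

/-- Branching on a vertex `v` of degree one with neighbour `u`. -/
lemma weight_le_of_nbrs_eq_singleton (ht : ∀ a b c, G.Adj a b → G.Adj a c → ¬ G.Adj b c)
    {S : Finset V} (hI : ∀ T ⊂ S, weight G T ≤ 1) {u v : V} (hv : v ∈ S)
    (h : nbrs G S v = {u}) : weight G S ≤ 0.94 := by
  have hu : u ∈ S ∧ G.Adj v u := mem_nbrs.1 (by rw [h]; exact mem_singleton_self u)
  have hd : #(nbrs G S v) = 1 := by rw [h, card_singleton]
  -- If `u ∉ F`, maximality puts `v` in `F`, isolated. If `u` were isolated in `F`, then `v` could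
  -- be added.
  have hcov : ∀ F ∈ maxDissoc G S, IsolatedIn G v F ∨ ∃ w ∈ nbrs G S u, u ∈ F ∧ w ∈ F := by
    intro F hF
    have hF' := mem_maxDissoc.1 hF
    have honly : ∀ w ∈ F, G.Adj v w → w = u := fun w hw hvw => by
      have : w ∈ nbrs G S v := mem_nbrs.2 ⟨hF'.1 hw, hvw⟩
      simpa [h] using this
    by_cases huF : u ∈ F
    · right
      by_contra! hno
      have hiso : ∀ w ∈ F, ¬ G.Adj u w := fun w hw huw =>
        hno w (mem_nbrs.2 ⟨hF'.1 hw, huw⟩) huF hw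
      by_cases hvF : v ∈ F
      · exact hiso v hvF hu.2.symm
      · exact not_isDissoc_insert hF hv hvF
          (isDissoc_insert_of_isolated hF'.2.1 huF hiso honly)
    · left
      have h0 : ∀ w ∈ F, ¬ G.Adj v w := fun w hw hvw => huF (honly w hw hvw ▸ hw)
      refine ⟨?_, h0⟩
      by_contra hvF
      exact not_isDissoc_insert hF hv hvF (isDissoc_insert_of_forall_not_adj hF'.2.1 h0)
  have h1 := (weight_le_mass hcov).trans (mass_or_le _ _ _)
  have h2 := mass_isolatedIn_le_pow hI hv (k := 2) (by omega)
  have h3 := mass_exists_le_card_mul S (nbrs G S u) (fun w F => u ∈ F ∧ w ∈ F)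
    (t := rho ^ (#(nbrs G S u) + 1)) fun w hw => by
      rw [mem_nbrs] at hw
      exact mass_pair_le_pow ht hI hu.1 hw.1 hw.2
        (Nat.add_le_add_left (card_nbrs_pos hu.1 hw.2.symm) _)
  -- The sequence `d * rho ^ (d + 1)` peaks at `d = 2`; the value at `d = 1` is compared separately,
  -- using `rho > 1/2`.
  have h4 : (#(nbrs G S u) : ℝ) * rho ^ (#(nbrs G S u) + 1) ≤ 2 * rho ^ 3 := by
    have h5 := card_nbrs_pos hv hu.2.symm
    rcases h5.eq_or_lt with h5 | h5
    · rw [← h5]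
      have : 0.6 < rho := by
        refine lt_of_pow_lt_pow_left₀ 4 rho_pos.le ?_
        rw [rho_pow_four]; norm_num
      have e : rho ^ 3 = rho * rho ^ 2 := by ring
      norm_num
      nlinarith [sq_nonneg rho]
    · exact_mod_cast mul_rho_pow_le 1 le_rfl h5
  linarith [rho_sq_lt, rho_cube_lt]

lemma weight_le_of_card_nbrs_le_one (ht : ∀ a b c, G.Adj a b → G.Adj a c → ¬ G.Adj b c)
    {S : Finset V} (hI : ∀ T ⊂ S, weight G T ≤ 1) {v : V} (hv : v ∈ S)
    (h : #(nbrs G S v) ≤ 1) : weight G S ≤ 0.94 := by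
  rcases Nat.le_one_iff_eq_zero_or_eq_one.1 h with h | h
  · rw [card_eq_zero] at h
    linarith [weight_le_of_nbrs_eq_empty hI hv h, rho_lt]
  · obtain ⟨u, hu⟩ := card_eq_one.1 h
    exact weight_le_of_nbrs_eq_singleton ht hI hv hu

/-- Branching on an arbitrary vertex. -/
lemma weight_le_branch {S : Finset V} {v : V} (hv : v ∈ S) :
    weight G S ≤ rho * weight G (S.erase v) + mass G S (IsolatedIn G v) +
      mass G S (fun F => ∃ u ∈ nbrs G S v, v ∈ F ∧ u ∈ F) := by
  have hcov : ∀ F ∈ maxDissoc G S,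
      (v ∉ F ∨ IsolatedIn G v F) ∨ ∃ u ∈ nbrs G S v, v ∈ F ∧ u ∈ F := by
    intro F hF
    have hF' := mem_maxDissoc.1 hF
    by_cases hvF : v ∈ F
    · by_cases h0 : ∀ w ∈ F, ¬ G.Adj v w
      · exact Or.inl (Or.inr ⟨hvF, h0⟩)
      · push Not at h0
        obtain ⟨w, hw, hvw⟩ := h0
        exact Or.inr ⟨w, mem_nbrs.2 ⟨hF'.1 hw, hvw⟩, hvF, hw⟩
    · exact Or.inl (Or.inl hvF)
  have h1 := (weight_le_mass hcov).trans (mass_or_le _ _ _)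
  have h2 := mass_or_le (G := G) S (fun F => v ∉ F) (IsolatedIn G v)
  have h3 := mass_notMem_le (G := G) hv
  linarith

/-- Branching on a vertex `u` of degree two with neighbours `a` and `b`. -/
lemma weight_le_branch_two {S : Finset V} {u a b : V} (hu : u ∈ S) (h : nbrs G S u = {a, b}) :
    weight G S ≤ mass G S (IsolatedIn G u) +
      mass G S (fun F => ∃ c ∈ nbrs G S a, a ∈ F ∧ c ∈ F) +
      mass G S (fun F => ∃ c ∈ nbrs G S b, b ∈ F ∧ c ∈ F) +
      mass G S (fun F => IsolatedIn G a F ∧ IsolatedIn G b F) := by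
  have ha : a ∈ S ∧ G.Adj u a := mem_nbrs.1 (by rw [h]; simp)
  have hb : b ∈ S ∧ G.Adj u b := mem_nbrs.1 (by rw [h]; simp)
  -- Failing the first three events, `a` and `b` are isolated in `F` whenever present, and `u ∉ F`.
  -- If at most one of them were present, `u` could be added.
  have hcov : ∀ F ∈ maxDissoc G S, ((IsolatedIn G u F ∨ ∃ c ∈ nbrs G S a, a ∈ F ∧ c ∈ F) ∨
      ∃ c ∈ nbrs G S b, b ∈ F ∧ c ∈ F) ∨ (IsolatedIn G a F ∧ IsolatedIn G b F) := by
    intro F hF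
    have hF' := mem_maxDissoc.1 hF
    by_contra! hno
    obtain ⟨⟨⟨n1, n2⟩, n3⟩, n4⟩ := hno
    have hau : ∀ w ∈ F, G.Adj u w → w = a ∨ w = b := fun w hw huw => by
      have : w ∈ nbrs G S u := mem_nbrs.2 ⟨hF'.1 hw, huw⟩
      simpa [h] using this
    have ia : a ∈ F → ∀ w ∈ F, ¬ G.Adj a w := fun haF w hw haw =>
      n2 w (mem_nbrs.2 ⟨hF'.1 hw, haw⟩) haF hw
    have ib : b ∈ F → ∀ w ∈ F, ¬ G.Adj b w := fun hbF w hw hbw =>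
      n3 w (mem_nbrs.2 ⟨hF'.1 hw, hbw⟩) hbF hw
    by_cases huF : u ∈ F
    · refine n1 ⟨huF, fun w hw huw => ?_⟩
      rcases hau w hw huw with rfl | rfl
      · exact ia hw u huF huw.symm
      · exact ib hw u huF huw.symm
    · by_cases haF : a ∈ F
      · have hbF : b ∉ F := fun hbF => n4 ⟨haF, ia haF⟩ ⟨hbF, ib hbF⟩
        refine not_isDissoc_insert hF hu huF
          (isDissoc_insert_of_isolated hF'.2.1 haF (ia haF) fun w hw huw => ?_)
        exact (hau w hw huw).resolve_right fun e => hbF (e ▸ hw)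
      · by_cases hbF : b ∈ F
        · refine not_isDissoc_insert hF hu huF
            (isDissoc_insert_of_isolated hF'.2.1 hbF (ib hbF) fun w hw huw => ?_)
          exact (hau w hw huw).resolve_left fun e => haF (e ▸ hw)
        · refine not_isDissoc_insert hF hu huF
            (isDissoc_insert_of_forall_not_adj hF'.2.1 fun w hw huw => ?_)
          rcases hau w hw huw with rfl | rfl
          · exact haF hw
          · exact hbF hw
  have h1 := (weight_le_mass hcov).trans (mass_or_le _ _ _)
  have h2 := mass_or_le (G := G) S
    (fun F => IsolatedIn G u F ∨ ∃ c ∈ nbrs G S a, a ∈ F ∧ c ∈ F)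
    (fun F => ∃ c ∈ nbrs G S b, b ∈ F ∧ c ∈ F)
  have h3 := mass_or_le (G := G) S (IsolatedIn G u) (fun F => ∃ c ∈ nbrs G S a, a ∈ F ∧ c ∈ F)
  linarith

/-- The dissociation sets containing an edge at `a`, when all degrees are at least two. -/
lemma mass_exists_pair_le (ht : ∀ a b c, G.Adj a b → G.Adj a c → ¬ G.Adj b c)
    {S : Finset V} (hI : ∀ T ⊂ S, weight G T ≤ 1) {k : ℕ} {a : V} (ha : a ∈ S)
    (h2 : ∀ c ∈ nbrs G S a, k ≤ #(nbrs G S c)) :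
    mass G S (fun F => ∃ c ∈ nbrs G S a, a ∈ F ∧ c ∈ F) ≤
      #(nbrs G S a) * rho ^ (#(nbrs G S a) + k) :=
  mass_exists_le_card_mul S _ (fun c F => a ∈ F ∧ c ∈ F) fun c hc =>
    mass_pair_le_pow ht hI ha (mem_nbrs.1 hc).1 (mem_nbrs.1 hc).2
      (Nat.add_le_add_left (h2 c hc) _)

/-- A vertex of degree at least four is strictly suboptimal. -/
lemma weight_lt_one_of_four_le (ht : ∀ a b c, G.Adj a b → G.Adj a c → ¬ G.Adj b c)
    {S : Finset V} (hI : ∀ T ⊂ S, weight G T ≤ 1) (hmin : ∀ v ∈ S, 2 ≤ #(nbrs G S v))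
    {v : V} (hv : v ∈ S) (h4 : 4 ≤ #(nbrs G S v)) : weight G S < 1 := by
  by_cases hu : ∃ u ∈ nbrs G S v, #(nbrs G S u) = 2
  · obtain ⟨u, hu, hu2⟩ := hu
    rw [mem_nbrs] at hu
    obtain ⟨b, hb⟩ : ∃ b, nbrs G S u = {v, b} := by
      have hvu : v ∈ nbrs G S u := mem_nbrs.2 ⟨hv, hu.2.symm⟩
      have : #((nbrs G S u).erase v) = 1 := by rw [card_erase_of_mem hvu, hu2]
      obtain ⟨b, hb⟩ := card_eq_one.1 this
      exact ⟨b, by rw [← insert_erase hvu, hb]⟩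
    have hbm : b ∈ S ∧ G.Adj u b := mem_nbrs.1 (by rw [hb]; simp)
    have hne : v ≠ b := by
      rintro rfl
      rw [hb] at hu2
      simp at hu2
    -- The total is at most `rho ^ 3 + 4 * rho ^ 6 + 2 * rho ^ 4 + rho ^ 6`, about 0.93.
    have h1 := weight_le_branch_two hu.1 hb
    have h2 := mass_isolatedIn_le_pow hI hu.1 (k := 3) (by omega)
    have h3 := mass_exists_pair_le ht hI (k := 2) hv fun c hc => hmin c (mem_nbrs.1 hc).1
    have h5 := mass_exists_pair_le ht hI (k := 2) hbm.1 fun c hc => hmin c (mem_nbrs.1 hc).1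
    have h6 := mass_isolatedIn_pair_le_pow hI hv hbm.1 hne (ht _ _ _ hu.2.symm hbm.2)
      (k := 6) (by have := card_le_card (subset_union_left (s₁ := nbrs G S v)
        (s₂ := nbrs G S b)); omega)
    have h7 := mul_rho_pow_le 2 (by norm_num) h4
    have h8 := mul_rho_pow_le 2 le_rfl (hmin b hbm.1)
    norm_num [rho_pow_six, rho_pow_four] at h7 h8 h6
    linarith [rho_sq_lt, rho_cube_lt]
  · push Not at hu
    -- All neighbours of `v` now have degree at least 3, so the total is at most `rho + rho ^ 5 + 4
    -- * rho ^ 7`, about 0.92.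
    have h1 := weight_le_branch (G := G) hv
    have h2 := mass_isolatedIn_le_pow hI hv (k := 5) (by omega)
    have h3 := mass_exists_pair_le ht hI (k := 3) hv fun c hc => by
      have := hmin c (mem_nbrs.1 hc).1
      have := hu c hc
      omega
    have h4 := mul_rho_pow_le 3 (by norm_num) h4
    have h5 := hI _ (erase_ssubset hv)
    have h6 : rho * weight G (S.erase v) ≤ rho := by nlinarith [rho_pos]
    norm_num [rho_pow_five, rho_pow_seven] at h4 h2
    linarith [rho_lt, rho_cube_lt]

end Branching

end SimpleGraph

namespace SimpleGraph

open Finset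

section SmallDegrees

open scoped Classical

variable {V : Type*} {G : SimpleGraph V}

/-! ### Degrees two and three -/

lemma nbrs_sdiff (S D : Finset V) (v : V) : nbrs G (S \ D) v = nbrs G S v \ D := by
  ext w; simp only [mem_nbrs, mem_sdiff]; tauto

lemma nbrs_erase (S : Finset V) (v w : V) : nbrs G (S.erase v) w = (nbrs G S w).erase v := by
  ext z; simp only [mem_nbrs, mem_erase]; tauto

/-- Two vertices of degree two with the same neighbours are isolated together. -/
lemma mass_isolatedIn_le_of_twin {S : Finset V} (hI : ∀ T ⊂ S, weight G T ≤ 1) {u c a b : V}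
    (hu : u ∈ S) (hc : c ∈ S) (hne : c ≠ u) (hab : a ≠ b) (hNu : nbrs G S u = {a, b})
    (ha : a ∈ nbrs G S c) (hb : b ∈ nbrs G S c) (hc2 : #(nbrs G S c) = 2) :
    mass G S (IsolatedIn G u) ≤ rho ^ 4 := by
  have hNc : nbrs G S c = {a, b} := by
    symm
    refine eq_of_subset_of_card_le ?_ ?_
    · simp [insert_subset_iff, ha, hb]
    · rw [hc2, card_pair hab]
  have h := mass_isolatedIn_le (G := G) hu
  rw [hNu, card_pair hab] at h
  have hss : S \ insert u {a, b} ⊂ S :=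
    (ssubset_iff_of_subset sdiff_subset).2 ⟨u, hu, by simp⟩
  have hca : c ≠ a := fun e => (mem_nbrs.1 ha).2.ne e
  have hcb : c ≠ b := fun e => (mem_nbrs.1 hb).2.ne e
  -- Deleting the closed neighbourhood of `u` isolates its twin `c`, which yields one more factor
  -- `rho`.
  have h0 := weight_le_of_nbrs_eq_empty (S := S \ insert u {a, b})
    (fun T hT => hI T (hT.trans hss)) (v := c) (by simp [hc, hne, hca, hcb])
    (by rw [nbrs_sdiff, hNc]; exact sdiff_eq_empty_iff_subset.2 (subset_insert _ _))
  refine h.trans ?_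
  calc _ ≤ rho ^ (2 + 1) * rho := mul_le_mul_of_nonneg_left h0 (pow_pos rho_pos _).le
    _ = rho ^ 4 := by ring

/-- Sharpening of `mass_exists_pair_le` when `a` has a neighbour of degree at least three. -/
lemma mass_exists_pair_le_of_mem (ht : ∀ a b c, G.Adj a b → G.Adj a c → ¬ G.Adj b c)
    {S : Finset V} (hI : ∀ T ⊂ S, weight G T ≤ 1) (hmin : ∀ v ∈ S, 2 ≤ #(nbrs G S v)) {a c : V}
    (ha : a ∈ S) {d : ℕ} (hd : #(nbrs G S a) = d + 1) (hc : c ∈ nbrs G S a)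
    (hc3 : 3 ≤ #(nbrs G S c)) :
    mass G S (fun F => ∃ w ∈ nbrs G S a, a ∈ F ∧ w ∈ F) ≤ d * rho ^ (d + 3) + rho ^ (d + 4) := by
  have h1 : mass G S (fun F => ∃ w ∈ nbrs G S a, a ∈ F ∧ w ∈ F) ≤
      mass G S (fun F => ∃ w ∈ (nbrs G S a).erase c, a ∈ F ∧ w ∈ F) +
        mass G S (fun F => a ∈ F ∧ c ∈ F) := by
    refine mass_le_add fun F _ ⟨w, hw, haw⟩ => ?_
    by_cases h : w = c
    · exact Or.inr (h ▸ haw)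
    · exact Or.inl ⟨w, mem_erase.2 ⟨h, hw⟩, haw⟩
  have h2 := mass_exists_le_card_mul S ((nbrs G S a).erase c) (fun w F => a ∈ F ∧ w ∈ F)
    (t := rho ^ (d + 3)) fun w hw => by
      have hw := mem_nbrs.1 (mem_of_mem_erase hw)
      exact mass_pair_le_pow ht hI ha hw.1 hw.2 (by have := hmin w hw.1; omega)
  have h3 := mass_pair_le_pow ht hI ha (mem_nbrs.1 hc).1 (mem_nbrs.1 hc).2 (k := d + 4)
    (by omega)
  have h4 : #((nbrs G S a).erase c) = d := by rw [card_erase_of_mem hc, hd]; rfl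
  rw [h4] at h2
  linarith

lemma card_lt_card_union_of_not_subset {s t : Finset V} (h : ¬ s ⊆ t) : #t < #(s ∪ t) := by
  refine card_lt_card ⟨subset_union_right, fun h' => h (subset_union_left.trans h')⟩

/-- A vertex of degree two with two neighbours of degree three. -/
lemma weight_le_of_two_three_three (ht : ∀ a b c, G.Adj a b → G.Adj a c → ¬ G.Adj b c)
    {S : Finset V} (hI : ∀ T ⊂ S, weight G T ≤ 1) (hmin : ∀ v ∈ S, 2 ≤ #(nbrs G S v))
    {u a b : V} (hu : u ∈ S) (hab : a ≠ b) (hNu : nbrs G S u = {a, b})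
    (ha3 : #(nbrs G S a) = 3) (hb3 : #(nbrs G S b) = 3) : weight G S ≤ 0.97 := by
  have ha : a ∈ S ∧ G.Adj u a := mem_nbrs.1 (by rw [hNu]; simp)
  have hb : b ∈ S ∧ G.Adj u b := mem_nbrs.1 (by rw [hNu]; simp)
  have hu2 : #(nbrs G S u) = 2 := by rw [hNu, card_pair hab]
  have h1 := weight_le_branch_two hu hNu
  have h2 := mass_isolatedIn_le_pow hI hu (k := 3) (by omega)
  have h3 := mass_exists_pair_le ht hI (k := 2) ha.1 fun c hc => hmin c (mem_nbrs.1 hc).1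
  have h4 := mass_exists_pair_le ht hI (k := 2) hb.1 fun c hc => hmin c (mem_nbrs.1 hc).1
  rw [ha3] at h3
  rw [hb3] at h4
  norm_num [rho_pow_five] at h3 h4
  have hr := rho_lt
  have hr2 := rho_sq_lt
  have hr3 := rho_cube_lt
  have hnadj : ¬ G.Adj a b := ht _ _ _ ha.2 hb.2
  -- With unequal neighbourhoods the last event costs only `rho ^ 6`, which suffices. With equal
  -- ones it costs `rho ^ 5` and the crude sum just exceeds 1. The saving comes from a common
  -- neighbour: degree at least 3 lowers both edge terms, degree 2 makes it a twin of `u`.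
  by_cases hsub : nbrs G S a ⊆ nbrs G S b
  · have hcu := card_le_card (subset_union_right (s₁ := nbrs G S a) (s₂ := nbrs G S b))
    have h5 := mass_isolatedIn_pair_le_pow hI ha.1 hb.1 hab hnadj (k := 5) (by omega)
    rw [rho_pow_five] at h5
    by_cases hc : ∃ c ∈ nbrs G S a, 3 ≤ #(nbrs G S c)
    · obtain ⟨c, hca, hc3⟩ := hc
      have h6 := mass_exists_pair_le_of_mem ht hI hmin ha.1 (d := 2) ha3 hca hc3
      have h7 := mass_exists_pair_le_of_mem ht hI hmin hb.1 (d := 2) hb3 (hsub hca) hc3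
      norm_num [rho_pow_five, rho_pow_six] at h6 h7
      linarith
    · push Not at hc
      have hua : u ∈ nbrs G S a := mem_nbrs.2 ⟨hu, ha.2.symm⟩
      obtain ⟨c, hc'⟩ : ((nbrs G S a).erase u).Nonempty := by
        rw [← card_pos, card_erase_of_mem hua]; omega
      rw [mem_erase] at hc'
      have hca := mem_nbrs.1 hc'.2
      have hcb := mem_nbrs.1 (hsub hc'.2)
      have h6 := mass_isolatedIn_le_of_twin hI hu hca.1 hc'.1 hab hNu
        (mem_nbrs.2 ⟨ha.1, hca.2.symm⟩) (mem_nbrs.2 ⟨hb.1, hcb.2.symm⟩)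
        (by have := hc c hc'.2; have := hmin c hca.1; omega)
      rw [rho_pow_four] at h6
      linarith
  · have hcu := card_lt_card_union_of_not_subset hsub
    have h5 := mass_isolatedIn_pair_le_pow hI ha.1 hb.1 hab hnadj (k := 6) (by omega)
    rw [rho_pow_six] at h5
    linarith

/-- A vertex of degree two with a neighbour of degree two and a neighbour of degree three. -/
lemma weight_lt_one_of_two_two_three (ht : ∀ a b c, G.Adj a b → G.Adj a c → ¬ G.Adj b c)
    {S : Finset V} (hI : ∀ T ⊂ S, weight G T ≤ 1) (hmin : ∀ v ∈ S, 2 ≤ #(nbrs G S v))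
    {u a b : V} (hu : u ∈ S) (hab : a ≠ b) (hNu : nbrs G S u = {a, b})
    (ha2 : #(nbrs G S a) = 2) (hb3 : #(nbrs G S b) = 3) : weight G S < 1 := by
  have ha : a ∈ S ∧ G.Adj u a := mem_nbrs.1 (by rw [hNu]; simp)
  have hb : b ∈ S ∧ G.Adj u b := mem_nbrs.1 (by rw [hNu]; simp)
  have hu2 : #(nbrs G S u) = 2 := by rw [hNu, card_pair hab]
  have h1 := weight_le_branch_two hu hNu
  have h2 := mass_isolatedIn_le_pow hI hu (k := 3) (by omega)
  have h3 := mass_exists_pair_le ht hI (k := 2) ha.1 fun c hc => hmin c (mem_nbrs.1 hc).1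
  have h4 := mass_exists_pair_le ht hI (k := 2) hb.1 fun c hc => hmin c (mem_nbrs.1 hc).1
  rw [ha2] at h3
  rw [hb3] at h4
  norm_num [rho_pow_five, rho_pow_four] at h3 h4
  have hr := rho_lt
  have hr2 := rho_sq_lt
  have hr3 := rho_cube_lt
  have hnadj : ¬ G.Adj a b := ht _ _ _ ha.2 hb.2
  -- The same dichotomy: when nested, the other neighbour `c` of `a` is also adjacent to `b`, and
  -- either its degree is at least 3 or it is a twin of `u`.
  by_cases hsub : nbrs G S a ⊆ nbrs G S b
  · have hcu := card_le_card (subset_union_right (s₁ := nbrs G S a) (s₂ := nbrs G S b))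
    have h5 := mass_isolatedIn_pair_le_pow hI ha.1 hb.1 hab hnadj (k := 5) (by omega)
    rw [rho_pow_five] at h5
    have hua : u ∈ nbrs G S a := mem_nbrs.2 ⟨hu, ha.2.symm⟩
    obtain ⟨c, hc'⟩ : ((nbrs G S a).erase u).Nonempty := by
      rw [← card_pos, card_erase_of_mem hua]; omega
    rw [mem_erase] at hc'
    have hca := mem_nbrs.1 hc'.2
    have hcb := mem_nbrs.1 (hsub hc'.2)
    by_cases hc3 : 3 ≤ #(nbrs G S c)
    · have h6 := mass_exists_pair_le_of_mem ht hI hmin ha.1 (d := 1) ha2 hc'.2 hc3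
      have h7 := mass_exists_pair_le_of_mem ht hI hmin hb.1 (d := 2) hb3 (hsub hc'.2) hc3
      norm_num [rho_pow_five, rho_pow_six, rho_pow_four] at h6 h7
      linarith
    · have h6 := mass_isolatedIn_le_of_twin hI hu hca.1 hc'.1 hab hNu
        (mem_nbrs.2 ⟨ha.1, hca.2.symm⟩) (mem_nbrs.2 ⟨hb.1, hcb.2.symm⟩)
        (by have := hmin c hca.1; omega)
      rw [rho_pow_four] at h6
      linarith
  · have hcu := card_lt_card_union_of_not_subset hsub
    have h5 := mass_isolatedIn_pair_le_pow hI ha.1 hb.1 hab hnadj (k := 6) (by omega)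
    rw [rho_pow_six] at h5
    linarith

lemma exists_eq_pair_of_mem {s : Finset V} (h2 : #s = 2) {a : V} (ha : a ∈ s) :
    ∃ b, a ≠ b ∧ s = {a, b} := by
  have : #(s.erase a) = 1 := by rw [card_erase_of_mem ha, h2]
  obtain ⟨b, hb⟩ := card_eq_one.1 this
  have hb' : b ∈ s.erase a := by rw [hb]; simp
  exact ⟨b, (mem_erase.1 hb').1.symm, by rw [← insert_erase ha, hb]⟩

/-- A cubic component is strictly suboptimal. -/
lemma weight_lt_one_of_cubic (ht : ∀ a b c, G.Adj a b → G.Adj a c → ¬ G.Adj b c)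
    {S : Finset V} (hI : ∀ T ⊂ S, weight G T ≤ 1) (hmin : ∀ v ∈ S, 2 ≤ #(nbrs G S v))
    (hreg : ∀ v ∈ S, ∀ w ∈ nbrs G S v, #(nbrs G S w) = #(nbrs G S v))
    {v : V} (hv : v ∈ S) (h3 : #(nbrs G S v) = 3) : weight G S < 1 := by
  have h1 := weight_le_branch (G := G) hv
  have h2 := mass_isolatedIn_le_pow hI hv (k := 4) (by omega)
  have h4 := mass_exists_pair_le ht hI (k := 3) hv fun c hc => (h3 ▸ hreg v hv c hc).ge
  rw [h3] at h4
  norm_num [rho_pow_six, rho_pow_four] at h4 h2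
  -- The inductive bound 1 would give a total slightly above 1. Deleting `v` leaves a neighbour `u`
  -- of degree 2 whose two other neighbours, not adjacent to `v` by triangle-freeness, keep degree
  -- 3.
  have hsv : weight G (S.erase v) ≤ 0.97 := by
    obtain ⟨u, hu⟩ : (nbrs G S v).Nonempty := by rw [← card_pos]; omega
    have hu' := mem_nbrs.1 hu
    have hvu : v ∈ nbrs G S u := mem_nbrs.2 ⟨hv, hu'.2.symm⟩
    have hNu : #(nbrs G (S.erase v) u) = 2 := by
      rw [nbrs_erase, card_erase_of_mem hvu, hreg v hv u hu, h3]
    have hdeg : ∀ w ∈ nbrs G (S.erase v) u, #(nbrs G (S.erase v) w) = 3 := by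
      intro w hw
      rw [nbrs_erase, mem_erase] at hw
      have hvw : v ∉ nbrs G S w := fun h =>
        ht u v w hu'.2.symm (mem_nbrs.1 hw.2).2 (mem_nbrs.1 h).2.symm
      rw [nbrs_erase, erase_eq_of_notMem hvw, hreg u hu'.1 w hw.2, hreg v hv u hu, h3]
    obtain ⟨a, b, hab, hNab⟩ := card_eq_two.1 hNu
    refine weight_le_of_two_three_three ht (fun T hT => hI T (hT.trans (erase_ssubset hv))) ?_
      (mem_erase.2 ⟨hu'.2.ne', hu'.1⟩) hab hNab (hdeg a (by rw [hNab]; simp))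
      (hdeg b (by rw [hNab]; simp))
    intro w hw
    rw [mem_erase] at hw
    rw [nbrs_erase]
    by_cases hvw : v ∈ nbrs G S w
    · rw [card_erase_of_mem hvw,
        hreg v hv w (mem_nbrs.2 ⟨hw.2, (mem_nbrs.1 hvw).2.symm⟩), h3]
    · rw [erase_eq_of_notMem hvw]
      exact hmin w hw.2
  have h5 : rho * weight G (S.erase v) ≤ rho * 0.97 := mul_le_mul_of_nonneg_left hsv rho_pos.le
  linarith [rho_lt, rho_sq_lt]

/-- Deleting an edge and its neighbourhood leaves a vertex of degree at most one. -/
lemma mass_pair_le_of_mem (ht : ∀ a b c, G.Adj a b → G.Adj a c → ¬ G.Adj b c)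
    {S : Finset V} (hI : ∀ T ⊂ S, weight G T ≤ 1) {a c z y : V} (ha : a ∈ S) (hc : c ∈ S)
    (hac : G.Adj a c) (hz : z ∈ S \ (nbrs G S a ∪ nbrs G S c)) (hz2 : #(nbrs G S z) = 2)
    (hy : y ∈ nbrs G S a ∪ nbrs G S c) (hzy : y ∈ nbrs G S z) :
    mass G S (fun F => a ∈ F ∧ c ∈ F) ≤ 0.94 * rho ^ (#(nbrs G S a) + #(nbrs G S c)) := by
  have hss : S \ (nbrs G S a ∪ nbrs G S c) ⊂ S :=
    (ssubset_iff_of_subset sdiff_subset).2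
      ⟨a, ha, fun h => (mem_sdiff.1 h).2 (mem_union_right _ (mem_nbrs.2 ⟨ha, hac.symm⟩))⟩
  have h1 : #(nbrs G (S \ (nbrs G S a ∪ nbrs G S c)) z) ≤ 1 := by
    rw [nbrs_sdiff]
    have h2 : nbrs G S z \ (nbrs G S a ∪ nbrs G S c) ⊆ (nbrs G S z).erase y := by
      intro w hw
      rw [mem_sdiff] at hw
      exact mem_erase.2 ⟨fun e => hw.2 (e ▸ hy), hw.1⟩
    have h3 := card_le_card h2
    rw [card_erase_of_mem hzy, hz2] at h3
    exact h3
  have h2 := weight_le_of_card_nbrs_le_one ht (fun T hT => hI T (hT.trans hss)) hz h1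
  refine (mass_pair_le ht ha hc hac).trans ?_
  rw [mul_comm]
  exact mul_le_mul_of_nonneg_right h2 (pow_pos rho_pos _).le

/-- On the path `c, a, u, b, d`, prescribing the edge `au` leaves `d` without its neighbour `b`, and
prescribing `ac` leaves `b` without `u`. The remainder thus has a vertex of degree at most 1, so
each of the two edges at `a` costs `0.94 * rho ^ 4`. -/
lemma mass_exists_pair_le_of_path (ht : ∀ a b c, G.Adj a b → G.Adj a c → ¬ G.Adj b c)
    {S : Finset V} (hI : ∀ T ⊂ S, weight G T ≤ 1) (hreg : ∀ v ∈ S, #(nbrs G S v) = 2)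
    {u a b c d : V} (hu : u ∈ S) (hNu : nbrs G S u = {a, b})
    (huc : u ≠ c) (hNa : nbrs G S a = {u, c}) (hud : u ≠ d) (hNb : nbrs G S b = {u, d})
    (hcd : c ≠ d) :
    mass G S (fun F => ∃ w ∈ nbrs G S a, a ∈ F ∧ w ∈ F) ≤ 0.94 * (1 / 3) := by
  have ha : a ∈ S ∧ G.Adj u a := mem_nbrs.1 (by rw [hNu]; simp)
  have hb : b ∈ S ∧ G.Adj u b := mem_nbrs.1 (by rw [hNu]; simp)
  have hc : c ∈ S ∧ G.Adj a c := mem_nbrs.1 (by rw [hNa]; simp)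
  have hd : d ∈ S ∧ G.Adj b d := mem_nbrs.1 (by rw [hNb]; simp)
  have hnadj : ¬ G.Adj a b := ht _ _ _ ha.2 hb.2
  have h := mass_exists_le_card_mul S (nbrs G S a) (fun w F => a ∈ F ∧ w ∈ F)
    (t := 0.94 * (1 / 6)) fun w hw => by
      rw [hNa, mem_insert, mem_singleton] at hw
      rcases hw with rfl | rfl
      · have h := mass_pair_le_of_mem ht hI (z := d) (y := b) ha.1 hu ha.2.symm
          (by
            rw [hNa, hNu]
            simp only [mem_sdiff, mem_union, mem_insert, mem_singleton, not_or]
            exact ⟨hd.1, ⟨hud.symm, hcd.symm⟩, fun e => hnadj (e ▸ hd.2).symm, hd.2.ne'⟩)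
          (hreg d hd.1) (by rw [hNu]; simp) (mem_nbrs.2 ⟨hb.1, hd.2.symm⟩)
        rwa [hreg a ha.1, hreg _ hu, rho_pow_four] at h
      · have hbc : ¬ G.Adj b w := fun h => by
          have : w ∈ nbrs G S b := mem_nbrs.2 ⟨hc.1, h⟩
          rw [hNb, mem_insert, mem_singleton] at this
          exact this.elim huc.symm hcd
        have h := mass_pair_le_of_mem ht hI (z := b) (y := u) ha.1 hc.1 hc.2
          (by
            simp only [mem_sdiff, mem_union, mem_nbrs, not_or, not_and]
            exact ⟨hb.1, fun _ => hnadj, fun _ h => hbc h.symm⟩)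
          (hreg b hb.1) (by rw [hNa]; simp) (by rw [hNb]; simp)
        rwa [hreg a ha.1, hreg _ hc.1, rho_pow_four] at h
  rw [hreg a ha.1] at h
  push_cast at h
  linarith

/-- In a two-regular graph, a path on five vertices is strictly suboptimal. -/
lemma weight_lt_one_of_path (ht : ∀ a b c, G.Adj a b → G.Adj a c → ¬ G.Adj b c)
    {S : Finset V} (hI : ∀ T ⊂ S, weight G T ≤ 1) (hreg : ∀ v ∈ S, #(nbrs G S v) = 2)
    {u a b c d : V} (hu : u ∈ S) (hab : a ≠ b) (hNu : nbrs G S u = {a, b})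
    (huc : u ≠ c) (hNa : nbrs G S a = {u, c}) (hud : u ≠ d) (hNb : nbrs G S b = {u, d})
    (hcd : c ≠ d) : weight G S < 1 := by
  have ha : a ∈ S ∧ G.Adj u a := mem_nbrs.1 (by rw [hNu]; simp)
  have hb : b ∈ S ∧ G.Adj u b := mem_nbrs.1 (by rw [hNu]; simp)
  have h1 := weight_le_branch_two hu hNu
  have h2 := mass_isolatedIn_le_pow hI hu (k := 3) (by rw [hreg u hu])
  have h3 := mass_exists_pair_le_of_path ht hI hreg hu hNu huc hNa hud hNb hcd
  have h4 := mass_exists_pair_le_of_path ht hI hreg hu (by rw [hNu, pair_comm]) hud hNb huc hNa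
    hcd.symm
  have hcu := card_lt_card_union_of_not_subset (s := nbrs G S a) (t := nbrs G S b) (by
    rw [hNa, hNb]
    simp [insert_subset_iff, huc.symm, hcd])
  rw [hreg b hb.1] at hcu
  have h5 := mass_isolatedIn_pair_le_pow hI ha.1 hb.1 hab (ht _ _ _ ha.2 hb.2) (k := 5)
    (by omega)
  rw [rho_pow_five] at h5
  linarith [rho_lt, rho_cube_lt]

/-! ### Four-cycle components and the induction -/

/-- `u, a, c, b` is a four-cycle forming a component of `G[S]`. -/
structure IsFourCycleComponent (G : SimpleGraph V) (S : Finset V) (u a c b : V) : Prop where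
  mem : u ∈ S
  ne : a ≠ b
  ne' : u ≠ c
  nbrs_u : nbrs G S u = {a, b}
  nbrs_a : nbrs G S a = {u, c}
  nbrs_b : nbrs G S b = {u, c}
  nbrs_c : nbrs G S c = {a, b}

namespace IsFourCycleComponent

variable {S : Finset V} {u a c b : V}

lemma adj_ua (h : IsFourCycleComponent G S u a c b) : a ∈ S ∧ G.Adj u a :=
  mem_nbrs.1 (by rw [h.nbrs_u]; simp)

lemma adj_ub (h : IsFourCycleComponent G S u a c b) : b ∈ S ∧ G.Adj u b :=
  mem_nbrs.1 (by rw [h.nbrs_u]; simp)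

lemma adj_ac (h : IsFourCycleComponent G S u a c b) : c ∈ S ∧ G.Adj a c :=
  mem_nbrs.1 (by rw [h.nbrs_a]; simp)

lemma adj_bc (h : IsFourCycleComponent G S u a c b) : c ∈ S ∧ G.Adj b c :=
  mem_nbrs.1 (by rw [h.nbrs_b]; simp)

lemma subset (h : IsFourCycleComponent G S u a c b) : {u, a, c, b} ⊆ S := by
  simp [insert_subset_iff, h.mem, h.adj_ua.1, h.adj_ub.1, h.adj_ac.1]

lemma card_eq (h : IsFourCycleComponent G S u a c b) : #({u, a, c, b} : Finset V) = 4 := by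
  rw [card_insert_of_notMem, card_insert_of_notMem, card_pair h.adj_bc.2.ne']
  · simp [h.adj_ac.2.ne, h.ne]
  · simp [h.adj_ua.2.ne, h.adj_ub.2.ne, h.ne']

lemma nbrs_subset (h : IsFourCycleComponent G S u a c b) :
    ∀ v ∈ ({u, a, c, b} : Finset V), nbrs G S v ⊆ {u, a, c, b} := by
  intro v hv
  simp only [mem_insert, mem_singleton] at hv
  rcases hv with rfl | rfl | rfl | rfl
  · rw [h.nbrs_u]; simp [insert_subset_iff]
  · rw [h.nbrs_a]; simp [insert_subset_iff]
  · rw [h.nbrs_c]; simp [insert_subset_iff]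
  · rw [h.nbrs_b]; simp [insert_subset_iff]

/-- Any three vertices of a four-cycle contain a vertex together with both its neighbours. -/
lemma card_inter_le (h : IsFourCycleComponent G S u a c b) {F : Finset V} (hF : IsDissoc G F) :
    #(F ∩ {u, a, c, b}) ≤ 2 := by
  have h1 : ¬ (u ∈ F ∧ a ∈ F ∧ b ∈ F) := fun ⟨x, y, z⟩ =>
    h.ne (hF u x a y b z h.adj_ua.2 h.adj_ub.2)
  have h2 : ¬ (c ∈ F ∧ a ∈ F ∧ b ∈ F) := fun ⟨x, y, z⟩ =>
    h.ne (hF c x a y b z h.adj_ac.2.symm h.adj_bc.2.symm)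
  have h3 : ¬ (a ∈ F ∧ u ∈ F ∧ c ∈ F) := fun ⟨x, y, z⟩ =>
    h.ne' (hF a x u y c z h.adj_ua.2.symm h.adj_ac.2)
  have h4 : ¬ (b ∈ F ∧ u ∈ F ∧ c ∈ F) := fun ⟨x, y, z⟩ =>
    h.ne' (hF b x u y c z h.adj_ub.2.symm h.adj_bc.2)
  have key : ∃ x y, F ∩ {u, a, c, b} ⊆ {x, y} := by
    by_cases hu : u ∈ F <;> by_cases ha : a ∈ F <;> by_cases hc : c ∈ F
    · exact absurd ⟨ha, hu, hc⟩ h3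
    · exact ⟨u, a, fun w hw => by grind⟩
    · exact ⟨u, c, fun w hw => by grind⟩
    · exact ⟨u, b, fun w hw => by grind⟩
    · exact ⟨a, c, fun w hw => by grind⟩
    · exact ⟨a, b, fun w hw => by grind⟩
    · exact ⟨c, b, fun w hw => by grind⟩
    · exact ⟨b, b, fun w hw => by grind⟩
  obtain ⟨x, y, hxy⟩ := key
  exact (card_le_card hxy).trans card_le_two

/-- A smaller trace could be exchanged for the edge `ua`, since the component has no edges to the
rest of `S`. -/
lemma card_inter_eq (h : IsFourCycleComponent G S u a c b) {F : Finset V}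
    (hF : F ∈ maxDissoc G S) : #(F ∩ {u, a, c, b}) = 2 := by
  have hF' := mem_maxDissoc.1 hF
  refine le_antisymm (h.card_inter_le hF'.2.1) ?_
  have hsub : ({u, a} : Finset V) ⊆ {u, a, c, b} := by simp [insert_subset_iff]
  have hdis : Disjoint {u, a} (F \ {u, a, c, b}) := disjoint_sdiff.mono_left hsub
  have h1 : IsDissoc G ({u, a} ∪ F \ {u, a, c, b}) := by
    refine (isDissoc_pair u a).union (hF'.2.1.mono sdiff_subset) fun x hx y hy hxy => ?_
    rw [mem_sdiff] at hy
    exact hy.2 (h.nbrs_subset x (hsub hx) (mem_nbrs.2 ⟨hF'.1 hy.1, hxy⟩))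
  have h2 := hF'.2.2 _ (union_subset (hsub.trans h.subset) (sdiff_subset.trans hF'.1)) h1
  rw [card_union_of_disjoint hdis, card_pair h.adj_ua.2.ne] at h2
  have h3 := card_sdiff_add_card_inter F {u, a, c, b}
  omega

/-- The trace is one of `Nat.choose 4 2 = 6` pairs, each costing `rho ^ 4 = 1/6`: the only branching
here with no loss. -/
lemma weight_le (h : IsFourCycleComponent G S u a c b) :
    weight G S ≤ weight G (S \ {u, a, c, b}) := by
  have h1 : weight G S ≤ mass G S
      (fun F => ∃ P ∈ powersetCard 2 ({u, a, c, b} : Finset V), F ∩ {u, a, c, b} = P) :=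
    weight_le_mass fun F hF => ⟨_, mem_powersetCard.2 ⟨inter_subset_right, h.card_inter_eq hF⟩, rfl⟩
  have h2 := mass_exists_le_card_mul (G := G) S (powersetCard 2 ({u, a, c, b} : Finset V))
    (fun P F => F ∩ {u, a, c, b} = P) (t := rho ^ 4 * weight G (S \ {u, a, c, b}))
    fun P hP => by
      have := mass_le_of_inter_eq (G := G) h.subset (P := P)
        (p := fun F => F ∩ {u, a, c, b} = P) (fun _ _ h => h)
        fun v hv => h.nbrs_subset v ((mem_powersetCard.1 hP).1 hv)
      rwa [h.card_eq] at this
  rw [card_powersetCard, h.card_eq, rho_pow_four, show Nat.choose 4 2 = 6 from rfl] at h2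
  have h3 := h1.trans h2
  push_cast at h3
  linarith

end IsFourCycleComponent

/-- `G[S]` is a disjoint union of four-cycles. -/
inductive IsFourCycleUnion (G : SimpleGraph V) : Finset V → Prop
  | empty : IsFourCycleUnion G ∅
  | step {S : Finset V} {u a c b : V} : IsFourCycleComponent G S u a c b →
      IsFourCycleUnion G (S \ {u, a, c, b}) → IsFourCycleUnion G S

lemma weight_empty : weight G ∅ = 1 := by
  have : maxDissoc G ∅ = {∅} := by
    ext F
    simp only [mem_maxDissoc, subset_empty, mem_singleton]
    constructor
    · exact fun h => h.1
    · rintro rfl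
      exact ⟨rfl, fun v hv => by simp at hv, fun F' h _ => by simp [h]⟩
  simp [weight, this]

/-- Bound and equality case are proved together: every configuration except the empty set and a
four-cycle component is strict, so weight 1 can only be inherited by splitting off four-cycles. -/
theorem weight_le_one_and (ht : ∀ a b c, G.Adj a b → G.Adj a c → ¬ G.Adj b c) (S : Finset V) :
    weight G S ≤ 1 ∧ (weight G S = 1 → IsFourCycleUnion G S) := by
  induction S using Finset.strongInduction with
  | H S ih =>
    have hI : ∀ T ⊂ S, weight G T ≤ 1 := fun T hT => (ih T hT).1
    suffices h : weight G S < 1 ∨ S = ∅ ∨ ∃ u a c b, IsFourCycleComponent G S u a c b by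
      rcases h with h | rfl | ⟨u, a, c, b, h⟩
      · exact ⟨h.le, fun h' => absurd h' h.ne⟩
      · exact ⟨weight_empty.le, fun _ => .empty⟩
      · have h1 := h.weight_le
        have h2 := ih (S \ {u, a, c, b})
          ((ssubset_iff_of_subset sdiff_subset).2 ⟨u, h.mem, by simp⟩)
        exact ⟨h1.trans h2.1, fun h' => .step h (h2.2 (le_antisymm h2.1 (h' ▸ h1)))⟩
    by_cases hmin : ∃ v ∈ S, #(nbrs G S v) ≤ 1
    · obtain ⟨v, hv, h1⟩ := hmin
      left
      linarith [weight_le_of_card_nbrs_le_one ht hI hv h1]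
    push Not at hmin
    replace hmin : ∀ v ∈ S, 2 ≤ #(nbrs G S v) := hmin
    by_cases hmax : ∃ v ∈ S, 4 ≤ #(nbrs G S v)
    · obtain ⟨v, hv, h4⟩ := hmax
      exact Or.inl (weight_lt_one_of_four_le ht hI hmin hv h4)
    push Not at hmax
    by_cases hmix : ∃ u ∈ S, ∃ b ∈ nbrs G S u, #(nbrs G S u) = 2 ∧ #(nbrs G S b) = 3
    · obtain ⟨u, hu, b, hb, hu2, hb3⟩ := hmix
      left
      obtain ⟨a, hba, hNu⟩ := exists_eq_pair_of_mem hu2 hb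
      rw [pair_comm] at hNu
      have ha : a ∈ S := (mem_nbrs.1 (by rw [hNu]; simp : a ∈ nbrs G S u)).1
      rcases (by have := hmin a ha; have := hmax a ha; omega :
        #(nbrs G S a) = 2 ∨ #(nbrs G S a) = 3) with ha2 | ha3
      · exact weight_lt_one_of_two_two_three ht hI hmin hu hba.symm hNu ha2 hb3
      · linarith [weight_le_of_two_three_three ht hI hmin hu hba.symm hNu ha3 hb3]
    push Not at hmix
    have hreg : ∀ v ∈ S, ∀ w ∈ nbrs G S v, #(nbrs G S w) = #(nbrs G S v) := by
      intro v hv w hw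
      have hw' := mem_nbrs.1 hw
      have h1 := hmix v hv w hw
      have h2 := hmix w hw'.1 v (mem_nbrs.2 ⟨hv, hw'.2.symm⟩)
      have := hmin v hv
      have := hmin w hw'.1
      have := hmax v hv
      have := hmax w hw'.1
      omega
    by_cases hcub : ∃ v ∈ S, #(nbrs G S v) = 3
    · obtain ⟨v, hv, h3⟩ := hcub
      exact Or.inl (weight_lt_one_of_cubic ht hI hmin hreg hv h3)
    push Not at hcub
    have hreg2 : ∀ v ∈ S, #(nbrs G S v) = 2 := by
      intro v hv
      have := hmin v hv
      have := hmax v hv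
      have := hcub v hv
      omega
    rcases S.eq_empty_or_nonempty with rfl | ⟨u, hu⟩
    · exact Or.inr (Or.inl rfl)
    obtain ⟨a, b, hab, hNu⟩ := card_eq_two.1 (hreg2 u hu)
    have ha : a ∈ S ∧ G.Adj u a := mem_nbrs.1 (by rw [hNu]; simp)
    have hb : b ∈ S ∧ G.Adj u b := mem_nbrs.1 (by rw [hNu]; simp)
    obtain ⟨c, huc, hNa⟩ := exists_eq_pair_of_mem (hreg2 a ha.1) (mem_nbrs.2 ⟨hu, ha.2.symm⟩)
    obtain ⟨d, hud, hNb⟩ := exists_eq_pair_of_mem (hreg2 b hb.1) (mem_nbrs.2 ⟨hu, hb.2.symm⟩)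
    by_cases hcd : c = d
    · subst hcd
      have hca : c ∈ S ∧ G.Adj a c := mem_nbrs.1 (by rw [hNa]; simp)
      have hcb : c ∈ S ∧ G.Adj b c := mem_nbrs.1 (by rw [hNb]; simp)
      refine Or.inr (Or.inr ⟨u, a, c, b, hu, hab, huc, hNu, hNa, hNb, ?_⟩)
      symm
      refine eq_of_subset_of_card_le ?_ ?_
      · simp [insert_subset_iff, mem_nbrs, ha.1, hb.1, hca.2.symm, hcb.2.symm]
      · rw [hreg2 c hca.1, card_pair hab]
    · exact Or.inl (weight_lt_one_of_path ht hI hreg2 hu hab hNu huc hNa hud hNb hcd)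

end SmallDegrees

end SimpleGraph

namespace SimpleGraph

open Finset

/-! ### The extremal graphs -/

lemma card_le_two_of_isDissoc_cycleGraph : ∀ A : Finset (Fin 4),
    (∀ v ∈ A, ∀ a ∈ A, ∀ b ∈ A, (cycleGraph 4).Adj v a → (cycleGraph 4).Adj v b → a = b) →
      #A ≤ 2 := by
  simp only [cycleGraph_adj']
  decide

section Extremal

open scoped Classical

variable {V : Type*} {G : SimpleGraph V}

lemma isDissociationSet_iff {F : Finset V} : G.IsDissociationSet F ↔ IsDissoc G F := by
  unfold IsDissociationSet IsDissoc
  constructor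
  · intro h v hv a ha b hb hva hvb
    have h1 := (degree_le_maxDegree (G.induce (F : Set V)) ⟨v, hv⟩).trans h
    rw [← card_neighborFinset_eq_degree, card_le_one] at h1
    have h2 := h1 ⟨a, ha⟩ (by simpa using hva) ⟨b, hb⟩ (by simpa using hvb)
    exact congrArg Subtype.val h2
  · intro h
    refine maxDegree_le_of_forall_degree_le _ _ fun v => ?_
    rw [← card_neighborFinset_eq_degree, card_le_one]
    intro a ha b hb
    rw [mem_neighborFinset] at ha hb
    exact Subtype.ext (h v v.2 a a.2 b b.2 ha hb)

lemma numMaximumDissociationSets_eq [Fintype V] :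
    G.numMaximumDissociationSets = #(maxDissoc G univ) := by
  unfold numMaximumDissociationSets
  rw [← Set.ncard_coe_finset]
  congr 1
  ext F
  simp [IsMaximumDissociationSet, isDissociationSet_iff, mem_maxDissoc]

lemma IsFourCycleComponent.adj_iff {S : Finset V} {u a c b : V}
    (h : IsFourCycleComponent G S u a c b) (j k : Fin 4) :
    G.Adj (![u, a, c, b] j) (![u, a, c, b] k) ↔ (cycleGraph 4).Adj j k := by
  have hu : ∀ w ∈ S, G.Adj u w ↔ w = a ∨ w = b := fun w hw => by
    have := mem_nbrs (G := G) (S := S) (v := u) (w := w)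
    rw [h.nbrs_u] at this; simpa [hw] using this.symm
  have hc : ∀ w ∈ S, G.Adj c w ↔ w = a ∨ w = b := fun w hw => by
    have := mem_nbrs (G := G) (S := S) (v := c) (w := w)
    rw [h.nbrs_c] at this; simpa [hw] using this.symm
  have ha : ∀ w ∈ S, G.Adj a w ↔ w = u ∨ w = c := fun w hw => by
    have := mem_nbrs (G := G) (S := S) (v := a) (w := w)
    rw [h.nbrs_a] at this; simpa [hw] using this.symm
  have hb : ∀ w ∈ S, G.Adj b w ↔ w = u ∨ w = c := fun w hw => by
    have := mem_nbrs (G := G) (S := S) (v := b) (w := w)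
    rw [h.nbrs_b] at this; simpa [hw] using this.symm
  have mu := h.mem
  have ma := h.adj_ua.1
  have mb := h.adj_ub.1
  have mc := h.adj_ac.1
  have n1 := h.adj_ua.2.ne
  have n2 := h.adj_ub.2.ne
  have n3 := h.adj_ac.2.ne
  have n4 := h.adj_bc.2.ne
  have n5 := h.ne
  have n6 := h.ne'
  fin_cases j <;> fin_cases k <;>
    simp [cycleGraph_adj', hu, ha, hb, hc, mu, ma, mb, mc, n1, n2, n3, n4, n5, n6, n1.symm,
      n2.symm, n3.symm, n4.symm, n5.symm, n6.symm] <;> decide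

lemma IsFourCycleComponent.injective {S : Finset V} {u a c b : V}
    (h : IsFourCycleComponent G S u a c b) : Function.Injective ![u, a, c, b] := by
  have n1 := h.adj_ua.2.ne
  have n2 := h.adj_ub.2.ne
  have n3 := h.adj_ac.2.ne
  have n4 := h.adj_bc.2.ne
  have n5 := h.ne
  have n6 := h.ne'
  intro j k
  fin_cases j <;> fin_cases k <;>
    simp [n1, n2, n3, n4, n5, n6, n1.symm, n2.symm, n3.symm, n4.symm, n5.symm, n6.symm]

lemma IsFourCycleUnion.exists_embedding {S : Finset V} (h : IsFourCycleUnion G S) :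
    ∃ (l : ℕ) (φ : disjointCopies l (cycleGraph 4) ↪g G), ∀ v ∈ S, v ∈ Set.range φ := by
  -- The range is strengthened to exactly `S`, so that the next four-cycle is disjoint from the
  -- earlier copies and has no edges to them.
  suffices ∃ (l : ℕ) (φ : Fin l × Fin 4 → V), Function.Injective φ ∧
      (∀ v, v ∈ S ↔ ∃ x, φ x = v) ∧
      ∀ x y, G.Adj (φ x) (φ y) ↔ (disjointCopies l (cycleGraph 4)).Adj x y by
    obtain ⟨l, φ, h1, h2, h3⟩ := this
    exact ⟨l, ⟨⟨φ, h1⟩, fun {x y} => h3 x y⟩, fun v hv => (h2 v).1 hv⟩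
  induction h with
  | empty => exact ⟨0, fun x => x.1.elim0, fun x => x.1.elim0, fun v => by simp,
      fun x => x.1.elim0⟩
  | @step S u a c b h _ ih =>
    obtain ⟨l, φ, hinj, hrange, hadj⟩ := ih
    have hq : ∀ j, ![u, a, c, b] j ∈ ({u, a, c, b} : Finset V) := by
      intro j; fin_cases j <;> simp
    have hφ : ∀ x, φ x ∈ S ∧ φ x ∉ ({u, a, c, b} : Finset V) := fun x =>
      mem_sdiff.1 ((hrange _).2 ⟨x, rfl⟩)
    have hno : ∀ j x, ¬ G.Adj (![u, a, c, b] j) (φ x) := fun j x hjx =>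
      (hφ x).2 (h.nbrs_subset _ (hq j) (mem_nbrs.2 ⟨(hφ x).1, hjx⟩))
    let ψ : Fin (l + 1) × Fin 4 → V := fun x =>
      Fin.cases (motive := fun _ => V) (![u, a, c, b] x.2) (fun i => φ (i, x.2)) x.1
    have ψ0 : ∀ j, ψ (0, j) = ![u, a, c, b] j := fun j => rfl
    have ψs : ∀ i j, ψ (Fin.succ i, j) = φ (i, j) := fun i j => rfl
    refine ⟨l + 1, ψ, ?_, ?_, ?_⟩
    · rintro ⟨i, j⟩ ⟨i', j'⟩ hij
      induction i using Fin.cases with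
      | zero =>
        induction i' using Fin.cases with
        | zero => rw [h.injective hij]
        | succ i' =>
          rw [ψ0, ψs] at hij
          exact absurd (hij ▸ hq j) (hφ _).2
      | succ i =>
        induction i' using Fin.cases with
        | zero =>
          rw [ψ0, ψs] at hij
          exact absurd (hij ▸ hq j') (hφ _).2
        | succ i' =>
          rw [ψs, ψs] at hij
          have := hinj hij
          simp only [Prod.mk.injEq] at this ⊢
          exact ⟨congrArg _ this.1, this.2⟩
    · intro v
      constructor
      · intro hv
        by_cases hvQ : v ∈ ({u, a, c, b} : Finset V)
        · simp only [mem_insert, mem_singleton] at hvQ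
          rcases hvQ with rfl | rfl | rfl | rfl
          · exact ⟨(0, 0), rfl⟩
          · exact ⟨(0, 1), rfl⟩
          · exact ⟨(0, 2), rfl⟩
          · exact ⟨(0, 3), rfl⟩
        · obtain ⟨⟨i, j⟩, hx⟩ := (hrange v).1 (mem_sdiff.2 ⟨hv, hvQ⟩)
          exact ⟨(i.succ, j), hx⟩
      · rintro ⟨⟨i, j⟩, rfl⟩
        induction i using Fin.cases with
        | zero => exact h.subset (hq j)
        | succ i => exact (hφ _).1
    · rintro ⟨i, j⟩ ⟨i', j'⟩
      induction i using Fin.cases with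
      | zero =>
        induction i' using Fin.cases with
        | zero =>
          rw [ψ0, ψ0, h.adj_iff]
          simp [disjointCopies]
        | succ i' =>
          rw [ψ0, ψs]
          simp [disjointCopies, hno, (Fin.succ_ne_zero i').symm]
      | succ i =>
        induction i' using Fin.cases with
        | zero =>
          rw [ψ0, ψs]
          rw [G.adj_comm]
          simp [disjointCopies, hno, Fin.succ_ne_zero i]
        | succ i' =>
          rw [ψs, ψs, hadj]
          simp [disjointCopies]

/-- The trace of `F` on the `i`-th copy. -/
noncomputable def copyTrace {l : ℕ} {H : SimpleGraph (Fin 4)} (e : G ≃g disjointCopies l H)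
    (F : Finset V) (i : Fin l) : Finset (Fin 4) :=
  univ.filter fun j => e.symm (i, j) ∈ F

lemma card_eq_sum_copyTrace {l : ℕ} {H : SimpleGraph (Fin 4)} (e : G ≃g disjointCopies l H)
    (F : Finset V) : #F = ∑ i, #(copyTrace e F i) := by
  have h1 : #F = #((univ : Finset (Fin l)).sigma (copyTrace e F)) := by
    refine card_bij' (fun v _ => ⟨(e v).1, (e v).2⟩) (fun x _ => e.symm (x.1, x.2)) ?_ ?_ ?_ ?_
    · intro v hv; simp [copyTrace, hv]
    · intro x hx; simpa [copyTrace] using hx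
    · intro v hv; simp
    · intro x hx; simp
  rw [h1, card_sigma]

/-- Any two vertices in each copy form a dissociation set of size `2 * l`. It is maximum because no
dissociation set has a trace larger than 2 on a copy. -/
lemma six_pow_le_card_maxDissoc [Fintype V] {l : ℕ}
    (e : G ≃g disjointCopies l (cycleGraph 4)) : 6 ^ l ≤ #(maxDissoc G univ) := by
  have hc : #(Fintype.piFinset fun _ : Fin l => powersetCard 2 (univ : Finset (Fin 4))) = 6 ^ l := by
    rw [Fintype.card_piFinset_const, card_powersetCard]; simp [Nat.choose]
  rw [← hc]
  have htr : ∀ (s : Fin l → Finset (Fin 4)) i,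
      copyTrace e (univ.filter fun v => (e v).2 ∈ s (e v).1) i = s i := by
    intro s i; ext j; simp [copyTrace]
  refine card_le_card_of_injOn (fun s => univ.filter fun v => (e v).2 ∈ s (e v).1) ?_ ?_
  · intro s hs
    rw [mem_coe, Fintype.mem_piFinset] at hs
    have hs2 : ∀ i, #(s i) = 2 := fun i => (mem_powersetCard.1 (hs i)).2
    rw [mem_coe, mem_maxDissoc]
    refine ⟨subset_univ _, ?_, fun F' _ hF' => ?_⟩
    · intro v hv a ha b hb hva hvb
      simp only [mem_filter, mem_univ, true_and] at hv ha hb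
      have h1 := e.map_adj_iff.2 hva
      have h2 := e.map_adj_iff.2 hvb
      rw [← h1.1] at ha
      rw [← h2.1] at hb
      have hav : (e a).2 ∈ (s (e v).1).erase (e v).2 := mem_erase.2 ⟨h1.2.ne', ha⟩
      have hbv : (e b).2 ∈ (s (e v).1).erase (e v).2 := mem_erase.2 ⟨h2.2.ne', hb⟩
      have h3 : #((s (e v).1).erase (e v).2) ≤ 1 := by rw [card_erase_of_mem hv, hs2]
      exact e.injective (Prod.ext (h1.1.symm.trans h2.1) (card_le_one.1 h3 _ hav _ hbv))
    · rw [card_eq_sum_copyTrace e, card_eq_sum_copyTrace e]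
      refine sum_le_sum fun i _ => ?_
      rw [htr, hs2]
      refine card_le_two_of_isDissoc_cycleGraph _ fun v hv a ha b hb hva hvb => ?_
      simp only [copyTrace, mem_filter, mem_univ, true_and] at hv ha hb
      have h1 := hF' _ hv _ ha _ hb (e.symm.map_adj_iff.2 ⟨rfl, hva⟩)
        (e.symm.map_adj_iff.2 ⟨rfl, hvb⟩)
      exact congrArg Prod.snd (e.symm.injective h1)
  · intro s _ s' _ h
    funext i
    rw [← htr s i, ← htr s' i]
    exact congrArg (fun F => copyTrace e F i) h

lemma six_rpow_mul_rho_pow (n : ℕ) : (6 : ℝ) ^ ((n : ℝ) / 4) * rho ^ n = 1 := by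
  unfold rho
  rw [← Real.rpow_natCast, ← Real.rpow_mul (by norm_num), ← Real.rpow_add (by norm_num)]
  convert Real.rpow_zero (6 : ℝ) using 2
  ring

end Extremal

end SimpleGraph

open SimpleGraph in
theorem theorem1p4 {V : Type*} [Fintype V] (G : SimpleGraph V) (hG : G.CliqueFree 3) :
    (G.numMaximumDissociationSets : ℝ) ≤ (6 : ℝ) ^ ((Fintype.card V : ℝ) / 4) ∧
    ((G.numMaximumDissociationSets : ℝ) = (6 : ℝ) ^ ((Fintype.card V : ℝ) / 4) ↔
      4 ∣ Fintype.card V ∧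
        Nonempty (G ≃g SimpleGraph.disjointCopies (Fintype.card V / 4)
          (SimpleGraph.cycleGraph 4))) := by
  have ht : ∀ a b c, G.Adj a b → G.Adj a c → ¬ G.Adj b c := by
    classical
    exact fun a b c hab hac hbc => hG {a, b, c} (is3Clique_triple_iff.2 ⟨hab, hac, hbc⟩)
  obtain ⟨hle, heq⟩ := weight_le_one_and ht Finset.univ
  have hr := six_rpow_mul_rho_pow (Fintype.card V)
  have hp : 0 < rho ^ Fintype.card V := pow_pos rho_pos _
  have hw : weight G Finset.univ = G.numMaximumDissociationSets * rho ^ Fintype.card V := by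
    rw [numMaximumDissociationSets_eq]; rfl
  rw [hw] at hle heq
  have hbound : (G.numMaximumDissociationSets : ℝ) ≤ (6 : ℝ) ^ ((Fintype.card V : ℝ) / 4) :=
    le_of_mul_le_mul_right (hle.trans_eq hr.symm) hp
  refine ⟨hbound, fun h => ?_, fun ⟨h4, ⟨e⟩⟩ => le_antisymm hbound ?_⟩
  · obtain ⟨l, φ, hφ⟩ := (heq (by rw [h, hr])).exists_embedding
    have e := RelIso.ofSurjective φ fun v => hφ v (Finset.mem_univ v)
    -- The decomposition produces an unspecified `l`; counting vertices identifies it with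
    -- `Fintype.card V / 4`.
    have hcard : Fintype.card V = l * 4 := by
      rw [← Fintype.card_congr e.toEquiv]; simp
    rw [hcard, Nat.mul_div_cancel _ (by norm_num)]
    exact ⟨Dvd.intro_left l rfl, ⟨e.symm⟩⟩
  · obtain ⟨l, hl⟩ := h4
    have h6 := six_pow_le_card_maxDissoc e
    rw [← numMaximumDissociationSets_eq, hl, Nat.mul_div_cancel_left _ (by norm_num)] at h6
    have e6 : (6 : ℝ) ^ ((Fintype.card V : ℝ) / 4) = 6 ^ l := by
      rw [hl, ← Real.rpow_natCast]
      congr 1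
      push_cast
      ring
    rw [e6]
    exact_mod_cast h6
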